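/- Let $n\ge 5$. For $\alpha=(\alpha_3,\dots,\alpha_n,\theta)\in\mathbb C^{n-1}$ let $L(\alpha)$ be the $(n+1)$-dimensional complex (filiform Leibniz) algebra with basis $e_0,\dots,e_n$ and products $$[e_0,e_0]=e_2,\quad [e_i,e_0]=e_{i+1}\ (1\le i\le n-1),\quad [e_0,e_1]=\alpha_3e_3+\dots+\alpha_{n-1}e_{n-1}+\theta e_n,$$ $$[e_j,e_1]=\alpha_3e_{j+2}+\alpha_4e_{j+3}+\dots+\alpha_{n+1-j}e_n\ (1\le j\le n-2),$$ all other products of basis vectors being $0$. Define polynomials $\varphi_t(y;\alpha)$ recursively by $$\varphi_t(y;\alpha)=(1+y)\alpha_t-\sum_{k=3}^{t-1}c_{t,k}(y;\alpha)\,\varphi_k(y;\alpha)\quad(3\le t\le n),$$ $$\varphi_{n+1}(y;\alpha)=\theta+y\alpha_n-\sum_{k=3}^{n-1}c_{n,k}(y;\alpha)\,\varphi_k(y;\alpha),$$ where $$c_{t,k}(y;\alpha)=\sum_{j=1}^{k-1}\binom{k-1}{j}y^{j}\,S_{j,k}(t),\qquad S_{1,k}(t)=\alpha_{t+2-k},$$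 $$S_{j,k}(t)=\sum_{i_{j-1}=k+j}^{t}\ \sum_{i_{j-2}=k+j}^{i_{j-1}}\cdots\sum_{i_1=k+j}^{i_2}\alpha_{t+3-i_{j-1}}\,\alpha_{i_{j-1}+3-i_{j-2}}\cdots\alpha_{i_2+3-i_1}\,\alpha_{i_1+3-j-k}\quad(j\ge 2).$$ Put $\rho_t(x,y;\alpha)=x^t\varphi_{t+2}(y;\alpha)$ for $1\le t\le n-2$ and $\rho_{n-1}(x,y;\alpha)=x^{n-2}\varphi_{n+1}(y;\alpha)$. Let $U''_2$ be the set of the $L(\alpha)$ with $\alpha_3=0$, $\alpha_4\ne0$ and $\alpha_5\ne0$. Then two algebras $L(\alpha)$ and $L(\alpha')$ from $U''_2$ are isomorphic if and only if $$\rho_i\Big(\frac{\alpha_4}{\alpha_5},\frac{\alpha_5^2}{\alpha_4^3}-1;\alpha\Big)=\rho_i\Big(\frac{\alpha'_4}{\alpha'_5},\frac{\alpha_5'^2}{\alpha_4'^3}-1;\alpha'\Big)\quad\text{for all } i=4,\dots,n-1.$$ Moreover, for every $(a_4,\dots,a_{n-1})\in\mathbb C^{n-4}$ there is an algebra $L(\alpha)$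 from $U''_2$ such that $$\rho_i\Big(\frac{\alpha_4}{\alpha_5},\frac{\alpha_5^2}{\alpha_4^3}-1;\alpha\Big)=a_i\quad\text{for all } i=4,\dots,n-1.$$ -/

import Mathlib

noncomputable section

namespace FiliformLeibniz

/-- A parameter tuple `(α₃, …, αₙ, θ)`. -/
structure Params (n : ℕ) where
  a : Set.Icc 3 n → ℂ
  θ : ℂ

/-- The entry `αₜ` of a parameter tuple; meaningful for `3 ≤ t ≤ n`, and `0` for other `t`. -/
def Params.coef {n : ℕ} (α : Params n) (t : ℕ) : ℂ :=
  if h : 3 ≤ t ∧ t ≤ n then α.a ⟨t, h⟩ else 0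

/-- The basis vector `e_m` of `ℂ^(n+1)`, for `0 ≤ m ≤ n`. -/
def e (n m : ℕ) : Fin (n + 1) → ℂ := fun k => if (k : ℕ) = m then 1 else 0

/-- The multiplication table `[e_i, e_j]` of the first class of filiform Leibniz algebras. -/
def basisBracket {n : ℕ} (α : Params n) (i j : ℕ) : Fin (n + 1) → ℂ :=
  if j = 0 then
    if i = 0 then e n 2
    else if i ≤ n - 1 then e n (i + 1)
    else 0
  else if j = 1 then
    if i = 0 then (∑ t ∈ Finset.Icc 3 (n - 1), α.coef t • e n t) + α.θ • e n n
    else if i ≤ n - 2 then ∑ t ∈ Finset.Icc 3 (n + 1 - i), α.coef t • e n (i + t - 1)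
    else 0
  else 0

/-- The bilinear multiplication of the `(n+1)`-dimensional complex algebra `L(α)`. -/
def bracket {n : ℕ} (α : Params n) :
    (Fin (n + 1) → ℂ) →ₗ[ℂ] (Fin (n + 1) → ℂ) →ₗ[ℂ] (Fin (n + 1) → ℂ) :=
  (Pi.basisFun ℂ (Fin (n + 1))).constr ℂ fun i =>
    (Pi.basisFun ℂ (Fin (n + 1))).constr ℂ fun j => basisBracket α i j

/-- `L(α)` and `L(β)` are isomorphic algebras. -/
def Isomorphic {n : ℕ} (α β : Params n) : Prop :=
  ∃ g : (Fin (n + 1) → ℂ) ≃ₗ[ℂ] (Fin (n + 1) → ℂ),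
    ∀ x y, g (bracket α x y) = bracket β (g x) (g y)

/-- Nested sums with fixed lower limit `j + k`: `nestedSum z j k 0 m = z_{m+3-j-k}`, and
`nestedSum z j k (r+1) m = ∑_{i=j+k}^{m} z_{m+3-i} · nestedSum z j k r i`. -/
def nestedSum (z : ℕ → ℂ) (j k : ℕ) : ℕ → ℕ → ℂ
  | 0, m => z (m + 3 - (j + k))
  | r + 1, m => ∑ i ∈ Finset.Icc (j + k) m, z (m + 3 - i) * nestedSum z j k r i

/-- The factor of `φ_k` in the recursion for `φ_t`. Its summand with index `j` is
`C_{k-1}^{k-1-j} y^j` times a `(j-1)`-fold nested sum of products of `j` of the `z_i`. -/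
def recCoef (z : ℕ → ℂ) (y : ℂ) (t k : ℕ) : ℂ :=
  ∑ j ∈ Finset.Icc 1 (k - 1),
    ((k - 1).choose (k - 1 - j) : ℂ) * y ^ j * nestedSum z j k (j - 1) t

/-- The polynomials `φ_t(y; z)` for `3 ≤ t ≤ n`:
`φ_t = (1 + y) z_t - ∑_{k=3}^{t-1} recCoef(t, k) φ_k`. -/
def phi (z : ℕ → ℂ) (y : ℂ) (t : ℕ) : ℂ :=
  (1 + y) * z t - ∑ k ∈ (Finset.Icc 3 (t - 1)).attach, recCoef z y t k * phi z y k
termination_by t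
decreasing_by
  have h := Finset.mem_Icc.mp k.2
  omega

/-- The last polynomial `φ_{n+1}(y; α)`, which governs the parameter `θ`:
`φ_{n+1} = θ + y αₙ - ∑_{k=3}^{n-1} recCoef(n, k) φ_k`. -/
def phiLast {n : ℕ} (y : ℂ) (α : Params n) : ℂ :=
  α.θ + y * α.coef n
    - ∑ k ∈ Finset.Icc 3 (n - 1), recCoef α.coef y n k * phi α.coef y k

/-- The component `ρ_i(x, y; α)`, `1 ≤ i ≤ n - 1`, of the transformation `ρ(x, y; α)`. -/
def rho {n : ℕ} (i : ℕ) (x y : ℂ) (α : Params n) : ℂ :=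
  if i = n - 1 then x ^ (n - 2) * phiLast y α
  else x ^ i * phi α.coef y (i + 2)

/-- The closed set `F`, on parameters. -/
def setF (n : ℕ) : Set (Params n) :=
  {α | α.coef 3 * (α.coef 4 + 2 * α.coef 3 ^ 2) = 0}

/-- The subset of `F` where `α₃ = 0` and `α₄ + 2 α₃² ≠ 0`. -/
def setU2Prime (n : ℕ) : Set (Params n) :=
  {α | α ∈ setF n ∧ α.coef 3 = 0 ∧ α.coef 4 + 2 * α.coef 3 ^ 2 ≠ 0}

/-- The stratum `U₂''`. -/
def setU2 (n : ℕ) : Set (Params n) :=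
  {α | α ∈ setU2Prime n ∧ α.coef 5 ≠ 0}

/-- The value of `ρ_i(α₄/α₅, α₅²/α₄³ - 1; α)`. -/
def inv2 {n : ℕ} (i : ℕ) (α : Params n) : ℂ :=
  rho i (α.coef 4 / α.coef 5) (α.coef 5 ^ 2 / α.coef 4 ^ 3 - 1) α

end FiliformLeibniz

end

/-! Identify `e_{j+1}` with `X^j` modulo `X^n`, and put `a = ∑ α_t X^{t-2}`. Then `[c e_0 + p, d e_0
+ q] = X (c + p) (d + q(0) a) + c q(0) (θ - α_n) X^{n-1}` (`bracket_tail`), so brackets are products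
of series, up to a correction in `e_n`.

An isomorphism `L(α) → L(β)` then acts essentially by a substitution `X ↦ X M` with `M = A (1 + y
b)`, where `b` is the series of `β`. Comparing images of `[e_1, e_1]` gives `∑ α_t A^{t-2} (X (1 + y
b))^{t-1} = (1 + y) X b` modulo `X^n`, whose triangular solution is the recursion for `φ_t(y; β)`.
Hence isomorphism means `α_t A^{t-2} = φ_t(y; β)` and `(θ_α - α_n) A^{n-2} = θ_β - β_n` for some
nonzero `A`, `1 + y` (`Isomorphic.exists_phi_eq`, `isomorphic_of_phi_eq`).

If `α_3 = 0`, one choice of `A`, `y` makes `α_4 = α_5 = 1`; the remaining parameters are then the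
invariants, and distinct normal forms are not isomorphic. -/

noncomputable section

namespace FiliformLeibniz

open PowerSeries

/-! ### The recursion as a change of variable in power series -/

/-- The series `∑ z_{s+3} X^s`. -/
def shiftedSeries (z : ℕ → ℂ) : ℂ⟦X⟧ := PowerSeries.mk fun s => z (s + 3)

/-- The series `∑ z_t X^{t-2}`, summed over `t ≥ 3`. -/
def paramSeries (z : ℕ → ℂ) : ℂ⟦X⟧ := X * shiftedSeries z

lemma coeff_paramSeries (z : ℕ → ℂ) (s : ℕ) (hs : 1 ≤ s) :
    coeff s (paramSeries z) = z (s + 2) := by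
  obtain ⟨s, rfl⟩ := Nat.exists_eq_add_of_le' hs
  rw [paramSeries, coeff_succ_X_mul, shiftedSeries, coeff_mk]

lemma constantCoeff_paramSeries (z : ℕ → ℂ) : constantCoeff (paramSeries z) = 0 := by
  simp [paramSeries]

/-- Each further summation is a Cauchy product with one more copy of the series, once the index is
shifted by `j + k`. -/
lemma nestedSum_eq_coeff (z : ℕ → ℂ) (j k r : ℕ) :
    ∀ m, j + k ≤ m →
      nestedSum z j k r m = coeff (m - (j + k)) (shiftedSeries z ^ (r + 1)) := by
  induction r with
  | zero =>
    intro m hm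
    rw [nestedSum, zero_add, pow_one, shiftedSeries, coeff_mk]
    congr 1
    omega
  | succ r ih =>
    intro m hm
    obtain ⟨d, rfl⟩ := Nat.exists_eq_add_of_le hm
    rw [nestedSum, pow_succ, coeff_mul, Nat.add_sub_cancel_left,
      Finset.Nat.sum_antidiagonal_eq_sum_range_succ_mk, Finset.range_eq_Ico]
    rw [show Finset.Icc (j + k) (j + k + d) = Finset.Ico (0 + (j + k)) (d.succ + (j + k)) by
      ext i; simp; omega, ← Finset.sum_Ico_add']
    refine Finset.sum_congr rfl fun i hi => ?_
    have hi' := (Finset.mem_Ico.mp hi).2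
    rw [ih _ (by omega), Nat.add_sub_cancel, mul_comm, shiftedSeries, coeff_mk]
    congr 2
    omega

lemma nestedSum_eq_zero {z : ℕ → ℂ} (hz : ∀ t < 3, z t = 0) (j k r m : ℕ) (h : m < j + k) :
    nestedSum z j k r m = 0 := by
  cases r with
  | zero => exact hz _ (by omega)
  | succ r => rw [nestedSum, Finset.Icc_eq_empty (by omega), Finset.sum_empty]

/-- Binomial expansion; the term `j = 0` lives in degree `0 < t - k` and drops out. -/
lemma recCoef_eq_coeff {z : ℕ → ℂ} (hz : ∀ t < 3, z t = 0) (y : ℂ) {t k : ℕ} (hkt : k < t) :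
    recCoef z y t k = coeff (t - k) ((1 + C y * paramSeries z) ^ (k - 1)) := by
  rw [add_comm, add_pow, map_sum, Finset.range_eq_Ico,
    Finset.sum_eq_sum_Ico_succ_bot (by omega)]
  have h0 : coeff (t - k) ((C y * paramSeries z) ^ 0 * 1 ^ (k - 1 - 0)
      * (((k - 1).choose 0 : ℕ) : ℂ⟦X⟧)) = 0 := by
    simp [coeff_one]
    omega
  rw [h0, zero_add, recCoef]
  refine Finset.sum_congr (by ext; simp) fun j hj => ?_
  have hj' := Finset.mem_Icc.mp hj
  rw [Nat.choose_symm hj'.2, one_pow, mul_one, mul_pow, ← map_pow,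
    show (((k - 1).choose j : ℕ) : ℂ⟦X⟧) = C ((k - 1).choose j : ℂ) by simp,
    coeff_mul_C, coeff_C_mul, paramSeries, mul_pow, coeff_X_pow_mul']
  split_ifs with h
  · rw [nestedSum_eq_coeff z j k _ t (by omega), Nat.sub_add_cancel hj'.1,
      show t - (j + k) = t - k - j by omega]
    ring
  · rw [nestedSum_eq_zero hz _ _ _ _ (by omega)]
    ring

lemma phi_eq (z : ℕ → ℂ) (y : ℂ) (t : ℕ) :
    phi z y t = (1 + y) * z t - ∑ k ∈ Finset.Icc 3 (t - 1), recCoef z y t k * phi z y k := by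
  rw [phi, Finset.sum_attach (Finset.Icc 3 (t - 1)) fun k => recCoef z y t k * phi z y k]

lemma phi_zero_right (z : ℕ → ℂ) (t : ℕ) : phi z 0 t = z t := by
  rw [phi_eq, Finset.sum_eq_zero, add_zero, one_mul, sub_zero]
  intro k _
  rw [recCoef, Finset.sum_eq_zero, zero_mul]
  intro j hj
  have := (Finset.mem_Icc.mp hj).1
  rw [zero_pow (by omega)]
  ring

/-- The two recursions share their sum, so `θ` enters only through `θ - α_n`, the same quantity as
in the bracket. -/
lemma phiLast_eq {n : ℕ} (y : ℂ) (α : Params n) :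
    phiLast y α = phi α.coef y n + (α.θ - α.coef n) := by
  rw [phi_eq, phiLast]
  ring

/-- The system is unitriangular: the summand `k = t` is `w t` itself, since the powers have constant
term `1`. -/
lemma sum_Icc_phi_mul_coeff {z : ℕ → ℂ} (hz : ∀ t < 3, z t = 0) (y : ℂ) {t : ℕ} (ht : 3 ≤ t)
    (w : ℕ → ℂ) (hw : ∀ k, 3 ≤ k → k < t → w k = phi z y k) :
    ∑ k ∈ Finset.Icc 3 t, w k * coeff (t - k) ((1 + C y * paramSeries z) ^ (k - 1)) =
      (1 + y) * z t ↔ w t = phi z y t := by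
  obtain ⟨s, rfl⟩ := Nat.exists_eq_add_of_le' ht
  have hc : constantCoeff ((1 + C y * paramSeries z) ^ (s + 3 - 1)) = 1 := by
    simp [constantCoeff_paramSeries]
  rw [Finset.sum_Icc_succ_top (by omega), phi_eq, Nat.sub_self, coeff_zero_eq_constantCoeff_apply,
    hc, mul_one, eq_sub_iff_add_eq, add_comm, show s + 3 - 1 = s + 2 by omega]
  rw [Finset.sum_congr rfl fun k hk => ?_]
  have hk' := Finset.mem_Icc.mp hk
  rw [hw k hk'.1 (by omega), recCoef_eq_coeff hz y (by omega), mul_comm]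

lemma coeff_sum_pow (w : ℕ → ℂ) (m : ℂ⟦X⟧) {n t : ℕ} (ht : 3 ≤ t) (htn : t ≤ n) :
    coeff (t - 1) (∑ k ∈ Finset.Icc 3 n, C (w k) * (X * m) ^ (k - 1)) =
      ∑ k ∈ Finset.Icc 3 t, w k * coeff (t - k) (m ^ (k - 1)) := by
  rw [map_sum]
  symm
  refine Finset.sum_subset_zero_on_sdiff (Finset.Icc_subset_Icc_right htn) ?_ ?_
  · intro k hk
    simp only [Finset.mem_sdiff, Finset.mem_Icc] at hk
    rw [coeff_C_mul, mul_pow, coeff_X_pow_mul', if_neg (by omega), mul_zero]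
  · intro k hk
    have hk' := Finset.mem_Icc.mp hk
    rw [coeff_C_mul, mul_pow, coeff_X_pow_mul', if_pos (by omega),
      show t - 1 - (k - 1) = t - k by omega]

/-- The polynomials `φ_k` are the coefficients of the series obtained from `∑ z_t X^{t-1}` by
the change of variable `X ↦ X (1 + y ∑ z_t X^{t-2})`, up to the factor `1 + y`. -/
lemma X_pow_dvd_sub_iff_phi {z : ℕ → ℂ} (hz : ∀ t < 3, z t = 0) (y : ℂ) (n : ℕ) (w : ℕ → ℂ) :
    X ^ n ∣ (∑ k ∈ Finset.Icc 3 n, C (w k) * (X * (1 + C y * paramSeries z)) ^ (k - 1)) -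
        C (1 + y) * (X * paramSeries z) ↔
      ∀ t, 3 ≤ t → t ≤ n → w t = phi z y t := by
  have key : X ^ n ∣ (∑ k ∈ Finset.Icc 3 n, C (w k) *
        (X * (1 + C y * paramSeries z)) ^ (k - 1)) - C (1 + y) * (X * paramSeries z) ↔
      ∀ t, 3 ≤ t → t ≤ n →
        ∑ k ∈ Finset.Icc 3 t, w k * coeff (t - k) ((1 + C y * paramSeries z) ^ (k - 1)) =
          (1 + y) * z t := by
    have hcoeff : ∀ t, 3 ≤ t → coeff (t - 1) (C (1 + y) * (X * paramSeries z)) =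
        (1 + y) * z t := by
      intro t ht
      obtain ⟨s, rfl⟩ := Nat.exists_eq_add_of_le' ht
      rw [coeff_C_mul, show s + 3 - 1 = s + 1 + 1 by omega, coeff_succ_X_mul,
        coeff_paramSeries _ _ (by omega)]
    rw [X_pow_dvd_iff]
    constructor
    · intro h t ht htn
      have := h (t - 1) (by omega)
      rw [map_sub, coeff_sum_pow _ _ ht htn, hcoeff t ht] at this
      exact sub_eq_zero.mp this
    · intro h m hm
      rcases lt_or_ge m 2 with h2 | h2
      · refine X_pow_dvd_iff.mp (dvd_sub (Finset.dvd_sum fun k hk => ?_) ?_) m h2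
        · have hk' := (Finset.mem_Icc.mp hk).1
          rw [mul_pow]
          exact (Dvd.dvd.mul_right (pow_dvd_pow X (by omega)) _).mul_left _
        · exact Dvd.dvd.mul_left ⟨shiftedSeries z, by rw [paramSeries]; ring⟩ _
      · have := h (m + 1) (by omega) hm
        rw [← coeff_sum_pow w _ (by omega) hm, ← hcoeff _ (by omega)] at this
        rw [map_sub]
        exact sub_eq_zero.mpr this
  rw [key]
  constructor
  · intro h t
    induction t using Nat.strong_induction_on with
    | _ t ih =>
      intro ht htn
      exact (sum_Icc_phi_mul_coeff hz y ht w fun k hk hkt => ih k hkt hk (by omega)).mp (h t ht htn)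
  · intro h t ht htn
    exact (sum_Icc_phi_mul_coeff hz y ht w fun k hk hkt => h k hk (by omega)).mpr (h t ht htn)

/-! ### The algebra as truncated power series -/

lemma coef_eq_zero {n : ℕ} (α : Params n) {t : ℕ} (h : ¬(3 ≤ t ∧ t ≤ n)) : α.coef t = 0 :=
  dif_neg h

lemma coef_of_lt_three {n : ℕ} (α : Params n) : ∀ t < 3, α.coef t = 0 :=
  fun _ h => coef_eq_zero α (by omega)

/-- The vector `∑ p_j e_{j+1}` with the coefficients of a power series `p`. -/
def tail (n : ℕ) : ℂ⟦X⟧ →ₗ[ℂ] (Fin (n + 1) → ℂ) where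
  toFun p k := if (k : ℕ) = 0 then 0 else coeff (k - 1) p
  map_add' p q := by
    ext k
    simp only [Pi.add_apply, map_add]
    split_ifs <;> simp
  map_smul' c p := by
    ext k
    simp only [Pi.smul_apply, RingHom.id_apply, map_smul]
    split_ifs <;> simp

lemma tail_apply_zero {n : ℕ} (p : ℂ⟦X⟧) : tail n p 0 = 0 := by simp [tail]

lemma tail_apply_succ {n : ℕ} (p : ℂ⟦X⟧) (i : Fin n) : tail n p i.succ = coeff i p := by
  simp [tail]

lemma tail_eq_zero_iff {n : ℕ} {p : ℂ⟦X⟧} : tail n p = 0 ↔ X ^ n ∣ p := by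
  rw [X_pow_dvd_iff]
  constructor
  · intro h m hm
    have := congrFun h (Fin.succ ⟨m, hm⟩)
    rwa [tail_apply_succ] at this
  · intro h
    ext k
    refine Fin.cases (tail_apply_zero p) (fun i => ?_) k
    rw [tail_apply_succ]
    exact h i i.2

lemma tail_eq_tail_iff {n : ℕ} {p q : ℂ⟦X⟧} : tail n p = tail n q ↔ X ^ n ∣ p - q := by
  rw [← tail_eq_zero_iff, map_sub, sub_eq_zero]

lemma tail_C_mul {n : ℕ} (c : ℂ) (p : ℂ⟦X⟧) : tail n (C c * p) = c • tail n p := by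
  rw [← smul_eq_C_mul, map_smul]

lemma e_succ (n m : ℕ) : e n (m + 1) = tail n (X ^ m) := by
  ext k
  simp only [e, tail, LinearMap.coe_mk, AddHom.coe_mk, coeff_X_pow]
  split_ifs <;> first | rfl | omega

lemma e_eq_zero {n m : ℕ} (h : n < m) : e n m = 0 := by
  ext k
  simp only [e, Pi.zero_apply]
  rw [if_neg (by omega)]

lemma coeff_sum_C_mul_X_pow {n : ℕ} (f : Fin n → ℂ) (i : Fin n) :
    coeff i (∑ j : Fin n, C (f j) * X ^ (j : ℕ)) = f i := by
  simp only [map_sum, coeff_C_mul, coeff_X_pow]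
  rw [Finset.sum_eq_single i]
  · simp
  · intro j _ hj
    rw [if_neg fun h => hj (Fin.ext h.symm), mul_zero]
  · simp

lemma eq_smul_add_tail {n : ℕ} (x : Fin (n + 1) → ℂ) :
    x = x 0 • e n 0 + tail n (∑ i : Fin n, C (x i.succ) * X ^ (i : ℕ)) := by
  ext k
  refine Fin.cases ?_ (fun i => ?_) k
  · simp [tail_apply_zero, e]
  · rw [Pi.add_apply, tail_apply_succ, coeff_sum_C_mul_X_pow fun i => x i.succ]
    simp [e]

lemma paramSeries_coef_eq_sum {n : ℕ} (α : Params n) :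
    paramSeries α.coef = ∑ t ∈ Finset.Icc 3 n, C (α.coef t) * X ^ (t - 2) := by
  ext s
  rw [map_sum]
  rcases Nat.eq_zero_or_pos s with rfl | hs
  · rw [coeff_zero_eq_constantCoeff_apply, constantCoeff_paramSeries, Finset.sum_eq_zero]
    intro t ht
    have := (Finset.mem_Icc.mp ht).1
    rw [coeff_C_mul, coeff_X_pow, if_neg (by omega), mul_zero]
  · rw [coeff_paramSeries _ _ hs]
    simp only [coeff_C_mul, coeff_X_pow]
    by_cases h : s + 2 ≤ n
    · rw [Finset.sum_eq_single (s + 2)]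
      · simp
      · intro t ht hts
        have := (Finset.mem_Icc.mp ht).1
        rw [if_neg (by omega), mul_zero]
      · intro h'
        exact absurd (Finset.mem_Icc.mpr ⟨by omega, h⟩) h'
    · rw [coef_eq_zero α (by omega), Finset.sum_eq_zero]
      intro t ht
      have := (Finset.mem_Icc.mp ht)
      rw [if_neg (by omega), mul_zero]

lemma tail_X_pow_mul_paramSeries {n : ℕ} (α : Params n) (i : ℕ) :
    tail n (X ^ i * (X * paramSeries α.coef)) =
      ∑ t ∈ Finset.Icc 3 n, α.coef t • e n (i + t) := by
  rw [paramSeries_coef_eq_sum, Finset.mul_sum, Finset.mul_sum, map_sum]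
  refine Finset.sum_congr rfl fun t ht => ?_
  have := (Finset.mem_Icc.mp ht).1
  rw [show i + t = i + (t - 2) + 1 + 1 by omega, e_succ, ← tail_C_mul]
  congr 1
  ring

lemma basisBracket_of_two_le {n : ℕ} (α : Params n) (i : ℕ) {j : ℕ} (hj : 2 ≤ j) :
    basisBracket α i j = 0 := by
  rw [basisBracket, if_neg (by omega), if_neg (by omega)]

lemma basisBracket_zero_zero {n : ℕ} (α : Params n) : basisBracket α 0 0 = tail n X := by
  rw [basisBracket, if_pos rfl, if_pos rfl, e_succ, pow_one]

lemma basisBracket_succ_zero {n : ℕ} (α : Params n) (i : ℕ) :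
    basisBracket α (i + 1) 0 = tail n (X ^ i * X) := by
  rw [basisBracket, if_pos rfl, if_neg (by omega), ← pow_succ, ← e_succ]
  split_ifs with h
  · rfl
  · rw [e_eq_zero (by omega)]

lemma basisBracket_zero_one {n : ℕ} (hn : 3 ≤ n) (α : Params n) :
    basisBracket α 0 1 =
      tail n (X * paramSeries α.coef + C (α.θ - α.coef n) * X ^ (n - 1)) := by
  obtain ⟨n, rfl⟩ := Nat.exists_eq_add_of_le' hn
  have := tail_X_pow_mul_paramSeries α 0
  rw [pow_zero, one_mul] at this
  rw [basisBracket, if_neg (by omega), if_pos rfl, if_pos rfl, map_add, this,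
    Finset.sum_Icc_succ_top (by omega), tail_C_mul, ← e_succ]
  simp only [zero_add, show n + 3 - 1 = n + 2 by omega]
  module

lemma basisBracket_succ_one {n : ℕ} (hn : 3 ≤ n) (α : Params n) (i : ℕ) :
    basisBracket α (i + 1) 1 = tail n (X ^ i * (X * paramSeries α.coef)) := by
  rw [basisBracket, if_neg (by omega), if_pos rfl, if_neg (by omega),
    tail_X_pow_mul_paramSeries]
  split_ifs with h
  · rw [Finset.sum_congr rfl fun t _ => by rw [show i + 1 + t - 1 = i + t by omega]]
    refine Finset.sum_subset (Finset.Icc_subset_Icc_right (by omega)) fun t ht ht' => ?_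
    simp only [Finset.mem_Icc] at ht ht'
    rw [e_eq_zero (by omega), smul_zero]
  · refine (Finset.sum_eq_zero fun t ht => ?_).symm
    simp only [Finset.mem_Icc] at ht
    rw [e_eq_zero (by omega), smul_zero]

lemma bracket_apply {n : ℕ} (hn : 3 ≤ n) (α : Params n) (x y : Fin (n + 1) → ℂ) :
    bracket α x y = ∑ i : Fin (n + 1), x i •
      (y 0 • basisBracket α i 0 + y ⟨1, by omega⟩ • basisBracket α i 1) := by
  rw [bracket, Module.Basis.constr_apply_fintype]
  simp only [LinearMap.sum_apply, LinearMap.smul_apply, Module.Basis.constr_apply_fintype,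
    Pi.basisFun_equivFun, LinearEquiv.refl_apply]
  refine Finset.sum_congr rfl fun i _ => ?_
  congr 1
  obtain ⟨n, rfl⟩ := Nat.exists_eq_add_of_le' hn
  rw [Fin.sum_univ_succ, Fin.sum_univ_succ, Finset.sum_eq_zero, add_zero]
  · rfl
  · intro j _
    rw [basisBracket_of_two_le α _ (by simp), smul_zero]

/-- The bracket in terms of power series modulo `X ^ n`. -/
lemma bracket_tail {n : ℕ} (hn : 3 ≤ n) (α : Params n) (c d : ℂ) (p q : ℂ⟦X⟧) :
    bracket α (c • e n 0 + tail n p) (d • e n 0 + tail n q) =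
      tail n (X * (C c + p) * (C d + C (constantCoeff q) * paramSeries α.coef) +
        C (c * constantCoeff q * (α.θ - α.coef n)) * X ^ (n - 1)) := by
  rw [bracket_apply hn, Fin.sum_univ_succ]
  have h0 : ∀ (c : ℂ) (p : ℂ⟦X⟧), (c • e n 0 + tail n p) 0 = c := by
    intro c p
    simp [e, tail_apply_zero]
  have h1 : ∀ (c : ℂ) (p : ℂ⟦X⟧) (i : Fin n), (c • e n 0 + tail n p) i.succ = coeff i p := by
    intro c p i
    simp [e, tail_apply_succ]
  have h2 : (d • e n 0 + tail n q) ⟨1, by omega⟩ = constantCoeff q :=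
    (h1 d q ⟨0, by omega⟩).trans (by simp)
  simp only [h0, h1, h2, Fin.val_zero, Fin.val_succ, basisBracket_zero_zero,
    basisBracket_zero_one hn, basisBracket_succ_zero, basisBracket_succ_one hn]
  simp only [← tail_C_mul, ← map_add, ← map_sum]
  rw [tail_eq_tail_iff]
  have hp : X ^ n ∣ (∑ i : Fin n, C (coeff i p) * X ^ (i : ℕ)) - p := by
    rw [X_pow_dvd_iff]
    intro m hm
    rw [map_sub, sub_eq_zero]
    exact coeff_sum_C_mul_X_pow (fun i : Fin n => coeff i p) ⟨m, hm⟩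
  refine (hp.mul_right (X * (C d + C (constantCoeff q) * paramSeries α.coef))).trans
    (dvd_of_eq ?_)
  have hsum : (∑ i : Fin n, C (coeff i p) * X ^ (i : ℕ)) *
      (X * (C d + C (constantCoeff q) * paramSeries α.coef)) =
      ∑ i : Fin n, C (coeff i p) * (C d * (X ^ (i : ℕ) * X) +
        C (constantCoeff q) * (X ^ (i : ℕ) * (X * paramSeries α.coef))) := by
    rw [Finset.sum_mul]
    exact Finset.sum_congr rfl fun i _ => by ring
  rw [sub_mul, hsum]
  simp only [map_mul]
  ring

lemma smul_add_tail_inj {n : ℕ} {c d : ℂ} {p q : ℂ⟦X⟧}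
    (h : c • e n 0 + tail n p = d • e n 0 + tail n q) : c = d ∧ X ^ n ∣ p - q := by
  have hc : c = d := by
    have := congrFun h 0
    simpa [e, tail_apply_zero] using this
  subst hc
  exact ⟨rfl, tail_eq_tail_iff.mp (add_left_cancel h)⟩

lemma bracket_tail_e_zero {n : ℕ} (hn : 3 ≤ n) (α : Params n) (c : ℂ) (p : ℂ⟦X⟧) :
    bracket α (c • e n 0 + tail n p) (e n 0) = tail n (X * (C c + p)) := by
  have := bracket_tail hn α c 1 p 0
  simpa using this

lemma bracket_tail_e_one {n : ℕ} (hn : 3 ≤ n) (α : Params n) (c : ℂ) (p : ℂ⟦X⟧) :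
    bracket α (c • e n 0 + tail n p) (e n 1) =
      tail n (X * (C c + p) * paramSeries α.coef +
        C (c * (α.θ - α.coef n)) * X ^ (n - 1)) := by
  have := bracket_tail hn α c 0 p 1
  simpa [show e n 1 = tail n 1 from e_succ n 0] using this

lemma tail_X_mul_paramSeries {n : ℕ} (α : Params n) :
    tail n (X * paramSeries α.coef) =
      ∑ t ∈ Finset.Icc 3 n, α.coef t • tail n (X ^ (t - 1)) := by
  rw [← one_mul (X * _), ← pow_zero X, tail_X_pow_mul_paramSeries]
  refine Finset.sum_congr rfl fun t ht => ?_
  have := (Finset.mem_Icc.mp ht).1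
  rw [← e_succ, show 0 + t = t - 1 + 1 by omega]

/-! ### Numerical conditions forced by an isomorphism -/

lemma exists_eq_C_add_X_mul (p : ℂ⟦X⟧) : ∃ s, p = C (constantCoeff p) + X * s := by
  obtain ⟨s, hs⟩ := X_dvd_iff.mpr (show constantCoeff (p - C (constantCoeff p)) = 0 by simp)
  exact ⟨s, by rw [← hs]; ring⟩

lemma isUnit_of_constantCoeff_ne_zero {p : ℂ⟦X⟧} (h : constantCoeff p ≠ 0) : IsUnit p :=
  isUnit_iff_constantCoeff.mpr h.isUnit

lemma coeff_one_X_mul (p : ℂ⟦X⟧) : coeff 1 (X * p) = constantCoeff p := by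
  rw [← coeff_zero_eq_constantCoeff_apply, ← zero_add 1, coeff_succ_X_mul]

lemma sum_C_mul_pow_smul (a : ℕ → ℂ) (A : ℂ) (m : ℂ⟦X⟧) (n : ℕ) :
    ∑ t ∈ Finset.Icc 3 n, C (a t) * (X * (C A * m)) ^ (t - 1) =
      C A * ∑ t ∈ Finset.Icc 3 n, C (a t * A ^ (t - 2)) * (X * m) ^ (t - 1) := by
  rw [Finset.mul_sum]
  refine Finset.sum_congr rfl fun t ht => ?_
  obtain ⟨s, rfl⟩ := Nat.exists_eq_add_of_le' (Finset.mem_Icc.mp ht).1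
  rw [show s + 3 - 1 = s + 2 by omega, show s + 3 - 2 = s + 1 by omega]
  simp only [map_mul, map_pow]
  ring

/-- `A` is the `e_0`-coordinate of `g e_0` and `y = p0 / A`, with `p0` its `e_1`-coordinate. The
first family comes from `[e_1, e_1]`, the last equation from `[e_0 - e_1, e_1] = (θ - α_n) e_n`. -/
theorem Isomorphic.exists_phi_eq {n : ℕ} (hn : 3 ≤ n) {α β : Params n} (h : Isomorphic α β) :
    ∃ A y : ℂ, A ≠ 0 ∧ 1 + y ≠ 0 ∧
      (∀ t, 3 ≤ t → t ≤ n → α.coef t * A ^ (t - 2) = phi β.coef y t) ∧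
      (α.θ - α.coef n) * A ^ (n - 2) = β.θ - β.coef n := by
  obtain ⟨g, hg⟩ := h
  obtain ⟨A, p, hA⟩ : ∃ c p, g (e n 0) = c • e n 0 + tail n p := ⟨_, _, eq_smul_add_tail _⟩
  obtain ⟨B, q, hB⟩ : ∃ c p, g (e n 1) = c • e n 0 + tail n p := ⟨_, _, eq_smul_add_tail _⟩
  set b := paramSeries β.coef with hb
  have hb0 : constantCoeff b = 0 := constantCoeff_paramSeries _
  set p0 := constantCoeff p with hp0
  set q0 := constantCoeff q with hqdef
  set M := C A + C p0 * b with hM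
  have hM0 : constantCoeff M = A := by simp [hM, hb0]
  have hXn : (X : ℂ⟦X⟧) ^ (n - 1) = X * X ^ (n - 2) := by
    rw [← pow_succ', show n - 2 + 1 = n - 1 by omega]
  have hXn2 : (X : ℂ⟦X⟧) ^ (n - 1) = X ^ 2 * X ^ (n - 3) := by
    rw [← pow_add, show 2 + (n - 3) = n - 1 by omega]
  have hX2n : (X : ℂ⟦X⟧) ^ 2 ∣ X ^ n := pow_dvd_pow X (by omega)
  have hR : ∀ c r, bracket β (c • e n 0 + tail n r) (g (e n 0)) =
      tail n (X * (C c + r) * M + C (c * p0 * (β.θ - β.coef n)) * X ^ (n - 1)) := by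
    intro c r
    rw [hA, bracket_tail hn]
  have hR0 : ∀ r, bracket β (tail n r) (g (e n 0)) = tail n (X * r * M) := by
    intro r
    simpa using hR 0 r
  have hstep : ∀ r, g (tail n (X * r)) = bracket β (g (tail n r)) (g (e n 0)) := by
    intro r
    rw [← hg]
    have := bracket_tail_e_zero hn α 0 r
    simp only [zero_smul, zero_add, map_zero] at this
    rw [this]
  have h1 : ∀ s, ∃ s', g (tail n (X * s)) = tail n (X * s') := by
    intro s
    obtain ⟨c, r, hr⟩ : ∃ c r, g (tail n s) = c • e n 0 + tail n r := ⟨_, _, eq_smul_add_tail _⟩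
    refine ⟨(C c + r) * M + C (c * p0 * (β.θ - β.coef n)) * X ^ (n - 2), ?_⟩
    rw [hstep, hr, hR, hXn]
    congr 1
    ring
  have h2 : ∀ s, ∃ s', g (tail n (X ^ 2 * s)) = tail n (X ^ 2 * s') := by
    intro s
    obtain ⟨s', hs'⟩ := h1 s
    refine ⟨s' * M, ?_⟩
    rw [show X ^ 2 * s = X * (X * s) by ring, hstep, hs', hR0]
    congr 1
    ring
  -- If `g x = e_0`, then `[x, e_1]` lies in the `X^2` part, hence so does its image `[e_0, g e_1]`,
  -- whose coefficient at `X` is `B`.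
  have hB0 : B = 0 := by
    obtain ⟨c, r, hr⟩ : ∃ c r, g.symm (e n 0) = c • e n 0 + tail n r :=
      ⟨_, _, eq_smul_add_tail _⟩
    have hl := hg (g.symm (e n 0)) (e n 1)
    rw [g.apply_symm_apply, hr, bracket_tail_e_one hn, hB, hXn2] at hl
    obtain ⟨s', hs'⟩ := h2 ((C c + r) * shiftedSeries α.coef +
      C (c * (α.θ - α.coef n)) * X ^ (n - 3))
    have hr2 := bracket_tail hn β 1 B 0 q
    rw [one_smul, map_zero, add_zero] at hr2
    rw [hr2, paramSeries, show X * (C c + r) * (X * shiftedSeries α.coef) +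
      C (c * (α.θ - α.coef n)) * (X ^ 2 * X ^ (n - 3)) = X ^ 2 * ((C c + r) *
      shiftedSeries α.coef + C (c * (α.θ - α.coef n)) * X ^ (n - 3)) by ring, hs',
      tail_eq_tail_iff] at hl
    have hd := (dvd_sub_right (Dvd.intro s' rfl)).mp (hX2n.trans hl)
    rw [hXn2] at hd
    have hd' := (dvd_add_left (Dvd.intro_left _ rfl |>.trans
      (dvd_of_eq (by ring : (C (1 * constantCoeff q * (β.θ - β.coef n)) * X ^ (n - 3)) * X ^ 2 =
        C (1 * constantCoeff q * (β.θ - β.coef n)) * (X ^ 2 * X ^ (n - 3)))))).mp hd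
    have := X_pow_dvd_iff.mp hd' 1 (by omega)
    rw [mul_assoc, coeff_one_X_mul] at this
    simpa [constantCoeff_paramSeries] using this
  subst hB0
  rw [zero_smul, zero_add] at hB
  have hgx : ∀ c r, ∃ s', g (c • e n 0 + tail n r) =
      (c * A) • e n 0 + tail n (C c * p + C (constantCoeff r) * q + X * s') := by
    intro c r
    obtain ⟨s, hs⟩ := exists_eq_C_add_X_mul r
    obtain ⟨s', hs'⟩ := h1 s
    refine ⟨s', ?_⟩
    have hC : ∀ d : ℂ, tail n (C d) = d • e n 1 := by
      intro d
      rw [e_succ, ← tail_C_mul, pow_zero, mul_one]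
    conv_lhs => rw [hs]
    rw [map_add, map_smul, map_add, map_add, hC, map_smul, hA, hB, hs']
    simp only [map_add, tail_C_mul]
    module
  have hA0 : A ≠ 0 := by
    obtain ⟨c, r, hr⟩ : ∃ c r, g.symm (e n 0) = c • e n 0 + tail n r :=
      ⟨_, _, eq_smul_add_tail _⟩
    obtain ⟨s', hs'⟩ := hgx c r
    rw [← hr, g.apply_symm_apply] at hs'
    have := (smul_add_tail_inj (n := n) (c := 1) (p := 0)
      (Eq.trans (b := e n 0) (by rw [one_smul, map_zero, add_zero]) hs')).1
    rintro rfl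
    simp at this
  have hq0 : q0 ≠ 0 := by
    obtain ⟨c, r, hr⟩ : ∃ c r, g.symm (e n 1) = c • e n 0 + tail n r :=
      ⟨_, _, eq_smul_add_tail _⟩
    obtain ⟨s', hs'⟩ := hgx c r
    rw [← hr, g.apply_symm_apply] at hs'
    obtain ⟨h0, hd⟩ := smul_add_tail_inj (n := n) (c := 0) (p := 1)
      (by rw [← hs', e_succ, pow_zero, zero_smul, zero_add])
    have hc : c = 0 := by simpa [hA0] using h0.symm
    subst hc
    have := X_pow_dvd_iff.mp hd 0 (by omega)
    intro hq
    simp [← hqdef, hq] at this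
  -- This is `[e_0 - e_1, e_0] = 0` transported by `g`; its degree-one coefficient then yields `q0 =
  -- A + p0`.
  have hK : X ^ n ∣ X * (C A + (p - q)) * M +
      C (A * p0 * (β.θ - β.coef n)) * X ^ (n - 1) := by
    have hl := hg ((1 : ℂ) • e n 0 + tail n (-1)) (e n 0)
    rw [bracket_tail_e_zero hn, map_one, add_neg_cancel, mul_zero, map_zero, map_zero, map_add,
      one_smul, map_neg, map_neg, ← pow_zero X, ← e_succ, hA, hB, add_assoc, ← map_neg,
      ← map_add, ← hA, hR, ← sub_eq_add_neg] at hl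
    exact tail_eq_zero_iff.mp hl.symm
  have hq : q0 = A + p0 := by
    have := X_pow_dvd_iff.mp hK 1 (by omega)
    rw [map_add, coeff_C_mul, coeff_X_pow, if_neg (by omega), mul_zero, add_zero, mul_assoc,
      coeff_one_X_mul, map_mul, hM0] at this
    have h0 := (mul_eq_zero.mp this).resolve_right hA0
    simp only [map_add, map_sub, constantCoeff_C, ← hp0, ← hqdef] at h0
    linear_combination -h0
  have hMu : IsUnit M := isUnit_of_constantCoeff_ne_zero (by rwa [hM0])
  have hpow : ∀ j, g (tail n (X ^ j)) = tail n ((X * M) ^ j * q) := by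
    intro j
    induction j with
    | zero => rw [← e_succ, hB, pow_zero, one_mul]
    | succ j ih =>
      rw [pow_succ', hstep, ih, hR0]
      congr 1
      ring
  have hRB : ∀ c r, bracket β (c • e n 0 + tail n r) (tail n q) =
      tail n (X * (C c + r) * (C q0 * b) + C (c * q0 * (β.θ - β.coef n)) * X ^ (n - 1)) := by
    intro c r
    have := bracket_tail hn β c 0 r q
    rwa [zero_smul, zero_add, map_zero, zero_add] at this
  have hy : M = C A * (1 + C (p0 / A) * b) := by
    rw [mul_add, mul_one, ← mul_assoc, ← map_mul, mul_div_cancel₀ _ hA0]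
  have hqy : q0 = A * (1 + p0 / A) := by
    rw [hq]
    field_simp
  refine ⟨A, p0 / A, hA0, fun h => hq0 (by rw [hqy, h, mul_zero]), ?_, ?_⟩
  · refine (X_pow_dvd_sub_iff_phi (coef_of_lt_three β) (p0 / A) n
      fun t => α.coef t * A ^ (t - 2)).mp ?_
    have hl := hg (tail n 1) (e n 1)
    have h11 := bracket_tail_e_one hn α 0 1
    have hbb := hRB 0 q
    simp only [zero_smul, zero_add, map_zero, mul_one, zero_mul, add_zero] at h11 hbb
    rw [h11, hB, ← pow_zero X, ← e_succ, hB, hbb, tail_X_mul_paramSeries, map_sum,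
      Finset.sum_congr rfl fun t _ => by rw [map_smul, hpow, ← tail_C_mul], ← map_sum,
      tail_eq_tail_iff, Finset.sum_congr rfl fun t _ => (mul_assoc _ _ _).symm,
      ← Finset.sum_mul, hy, sum_C_mul_pow_smul, hqy] at hl
    have hu : IsUnit (C A * q) :=
      ((hA0.isUnit).map C).mul (isUnit_of_constantCoeff_ne_zero hq0)
    rw [← hu.dvd_mul_left]
    refine hl.trans (dvd_of_eq ?_)
    simp only [map_mul]
    ring
  · have hl := hg ((1 : ℂ) • e n 0 + tail n (-1)) (e n 1)
    rw [bracket_tail_e_one hn, map_one, add_neg_cancel, mul_zero, zero_mul, zero_add, one_mul,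
      tail_C_mul, map_smul, hpow, map_add,
      one_smul, map_neg, map_neg, ← pow_zero X, ← e_succ, hA, hB, add_assoc, ← map_neg,
      ← map_add, hRB, ← sub_eq_add_neg, ← tail_C_mul, tail_eq_tail_iff] at hl
    -- Multiply `hK` by `q0 b`: the correction dies because `X ∣ b`, and the unit `M` cancels. Only
    -- the `θ` terms then survive in degree `n - 1`.
    have hKb : X ^ n ∣ X * (C A + (p - q)) * (C q0 * b) := by
      have h3 := hK.mul_right (C q0 * b)
      rw [add_mul] at h3
      have h4 : X ^ n ∣ C (A * p0 * (β.θ - β.coef n)) * X ^ (n - 1) * (C q0 * b) := by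
        refine ⟨C (A * p0 * (β.θ - β.coef n)) * (C q0 * shiftedSeries β.coef), ?_⟩
        have hXs : (X : ℂ⟦X⟧) ^ n = X ^ (n - 1) * X := by
          rw [← pow_succ, Nat.sub_add_cancel (by omega)]
        rw [hb, paramSeries, hXs]
        ring
      rw [← hMu.dvd_mul_right]
      refine ((dvd_add_left h4).mp h3).trans (dvd_of_eq (by ring))
    have h5 := dvd_add hl hKb
    rw [sub_add, add_sub_cancel_left] at h5
    have h6 := X_pow_dvd_iff.mp h5 (n - 1) (by omega)
    rw [map_sub, coeff_C_mul, coeff_C_mul, coeff_X_pow_self, mul_pow, mul_assoc,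
      coeff_X_pow_mul', if_pos le_rfl, Nat.sub_self, coeff_zero_eq_constantCoeff_apply, map_mul,
      map_pow, hM0, ← hqdef, show n - 1 = n - 2 + 1 by omega, pow_succ] at h6
    refine mul_right_cancel₀ (mul_ne_zero hA0 hq0) ?_
    linear_combination h6

/-! ### Constructing an isomorphism from the conditions -/

lemma Isomorphic.symm {n : ℕ} {α β : Params n} (h : Isomorphic α β) : Isomorphic β α := by
  obtain ⟨g, hg⟩ := h
  exact ⟨g.symm, fun x y => by rw [g.symm_apply_eq, hg, g.apply_symm_apply, g.apply_symm_apply]⟩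

lemma Isomorphic.trans {n : ℕ} {α β γ : Params n} (h : Isomorphic α β) (h' : Isomorphic β γ) :
    Isomorphic α γ := by
  obtain ⟨g, hg⟩ := h
  obtain ⟨f, hf⟩ := h'
  exact ⟨g.trans f, fun x y => by
    rw [LinearEquiv.trans_apply, hg, hf, LinearEquiv.trans_apply, LinearEquiv.trans_apply]⟩

lemma X_pow_dvd_X_pow_mul_sub {n : ℕ} (hn : 1 ≤ n) (p : ℂ⟦X⟧) :
    X ^ n ∣ X ^ (n - 1) * (p - C (constantCoeff p)) := by
  obtain ⟨s, hs⟩ := exists_eq_C_add_X_mul p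
  refine ⟨s, ?_⟩
  conv_lhs => rw [hs]
  rw [show (X : ℂ⟦X⟧) ^ n = X ^ (n - 1) * X by rw [← pow_succ, Nat.sub_add_cancel hn]]
  simp
  ring

/-- The linear map sending `e_0` to `v` and `e_{j+1}` to `tail (f ^ j * r)`. -/
def powMap (n : ℕ) (v : Fin (n + 1) → ℂ) (f r : ℂ⟦X⟧) :
    (Fin (n + 1) → ℂ) →ₗ[ℂ] (Fin (n + 1) → ℂ) :=
  (Pi.basisFun ℂ (Fin (n + 1))).constr ℂ
    (Fin.cases v fun i : Fin n => tail n (f ^ (i : ℕ) * r))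

lemma basisFun_eq_e {n : ℕ} (i : Fin (n + 1)) : Pi.basisFun ℂ (Fin (n + 1)) i = e n i := by
  ext k
  simp [e, Pi.single_apply, Fin.ext_iff]

lemma powMap_e_zero {n : ℕ} (v : Fin (n + 1) → ℂ) (f r : ℂ⟦X⟧) : powMap n v f r (e n 0) = v := by
  have : e n 0 = Pi.basisFun ℂ (Fin (n + 1)) 0 := by rw [basisFun_eq_e]; rfl
  rw [this, powMap, Module.Basis.constr_basis]
  rfl

lemma powMap_tail_X_pow {n : ℕ} (v : Fin (n + 1) → ℂ) {f : ℂ⟦X⟧} (hf : X ∣ f) (r : ℂ⟦X⟧)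
    (j : ℕ) : powMap n v f r (tail n (X ^ j)) = tail n (f ^ j * r) := by
  by_cases hj : j < n
  · have : tail n (X ^ j) = Pi.basisFun ℂ (Fin (n + 1)) (Fin.succ ⟨j, hj⟩) := by
      rw [basisFun_eq_e, ← e_succ]; rfl
    rw [this, powMap, Module.Basis.constr_basis]
    rfl
  · rw [tail_eq_zero_iff.mpr (pow_dvd_pow X (not_lt.mp hj)), map_zero, tail_eq_zero_iff.mpr]
    exact ((pow_dvd_pow X (not_lt.mp hj)).trans (pow_dvd_pow_of_dvd hf j)).mul_right r

lemma powMap_tail_X_pow_mul_paramSeries {n : ℕ} (v : Fin (n + 1) → ℂ) {f : ℂ⟦X⟧} (hf : X ∣ f)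
    (r : ℂ⟦X⟧) (α : Params n) (i : ℕ) :
    powMap n v f r (tail n (X ^ i * (X * paramSeries α.coef))) =
      tail n (f ^ i * (∑ t ∈ Finset.Icc 3 n, C (α.coef t) * f ^ (t - 1)) * r) := by
  rw [tail_X_pow_mul_paramSeries, map_sum, Finset.mul_sum, Finset.sum_mul, map_sum]
  refine Finset.sum_congr rfl fun t ht => ?_
  have := (Finset.mem_Icc.mp ht).1
  rw [map_smul, show i + t = i + (t - 1) + 1 by omega, e_succ, powMap_tail_X_pow v hf,
    ← tail_C_mul, pow_add]
  congr 1
  ring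

/-- The matrix is triangular: the image of `e_{j+1}` starts with `c M(0)^j X^j`. -/
lemma powMap_injective {n : ℕ} {A c : ℂ} (hA : A ≠ 0) (hc : c ≠ 0) (p : ℂ⟦X⟧) {M : ℂ⟦X⟧}
    (hM : constantCoeff M ≠ 0) :
    Function.Injective (powMap n (A • e n 0 + tail n p) (X * M) (C c)) := by
  rw [← LinearMap.ker_eq_bot, LinearMap.ker_eq_bot']
  intro x hx
  rw [eq_smul_add_tail x, map_add, map_smul, powMap_e_zero, map_sum, map_sum,
    Finset.sum_congr rfl fun i _ => by
      rw [tail_C_mul, map_smul, powMap_tail_X_pow _ (Dvd.intro _ rfl), ← tail_C_mul],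
    ← map_sum] at hx
  have h0 : x 0 = 0 := by
    have := congrFun hx 0
    simpa [e, tail_apply_zero, hA] using this
  rw [h0, zero_smul, zero_add, tail_eq_zero_iff, X_pow_dvd_iff] at hx
  have hs : ∀ j : ℕ, ∀ hj : j < n, x (Fin.succ ⟨j, hj⟩) = 0 := by
    intro j
    induction j using Nat.strong_induction_on with
    | _ j ih =>
      intro hj
      have := hx j hj
      rw [map_sum, Finset.sum_eq_single ⟨j, hj⟩] at this
      · rw [coeff_C_mul, coeff_mul_C, mul_pow, coeff_X_pow_mul', if_pos le_rfl, Nat.sub_self,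
          coeff_zero_eq_constantCoeff_apply, map_pow] at this
        exact (mul_eq_zero.mp this).resolve_right (mul_ne_zero (pow_ne_zero _ hM) hc)
      · intro i _ hi
        rcases lt_or_ge (i : ℕ) j with hij | hij
        · rw [ih i hij i.2, map_zero, zero_mul, map_zero]
        · have : ¬(i : ℕ) ≤ j := fun h => hi (Fin.ext (le_antisymm h hij))
          rw [coeff_C_mul, coeff_mul_C, mul_pow, coeff_X_pow_mul', if_neg this, zero_mul, mul_zero]
      · simp
  ext k
  exact Fin.cases h0 (fun i => hs i i.2) k

theorem isomorphic_of_phi_eq {n : ℕ} (hn : 3 ≤ n) {α β : Params n} {A y : ℂ} (hA : A ≠ 0)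
    (hy : 1 + y ≠ 0)
    (h : ∀ t, 3 ≤ t → t ≤ n → α.coef t * A ^ (t - 2) = phi β.coef y t)
    (hθ : (α.θ - α.coef n) * A ^ (n - 2) = β.θ - β.coef n) : Isomorphic α β := by
  set b := paramSeries β.coef with hb
  have hb0 : constantCoeff b = 0 := constantCoeff_paramSeries _
  set M := C A * (1 + C y * b) with hM
  have hM0 : constantCoeff M = A := by simp [hM, hb0]
  have hXM : X ∣ X * M := Dvd.intro _ rfl
  -- Chosen so that `X w M` cancels the `X^{n-1}` correction in `[g e_0, g e_0]`, which must equal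
  -- `g e_2`.
  set w := C (-(A * y) * (β.θ - β.coef n)) * X ^ (n - 2) with hw
  have hXw : X * w = C (-(A * y) * (β.θ - β.coef n)) * X ^ (n - 1) := by
    rw [hw, show n - 1 = n - 2 + 1 by omega]
    ring
  have hw0 : constantCoeff w = 0 := by
    rw [hw, map_mul, map_pow, constantCoeff_X, zero_pow (by omega), mul_zero]
  set v := A • e n 0 + tail n (C (A * y) + w) with hv
  set g := powMap n v (X * M) (C (A * (1 + y))) with hg
  have hinj : Function.Injective g :=
    powMap_injective hA (mul_ne_zero hA hy) _ (by rwa [hM0])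
  have hgX : ∀ j, g (tail n (X ^ j)) = tail n ((X * M) ^ j * C (A * (1 + y))) :=
    powMap_tail_X_pow v hXM _
  have hg0 : g (e n 0) = v := powMap_e_zero _ _ _
  have hsum : X ^ n ∣ (∑ t ∈ Finset.Icc 3 n, C (α.coef t) * (X * M) ^ (t - 1)) -
      C (A * (1 + y)) * (X * b) := by
    rw [hM, sum_C_mul_pow_smul, map_mul, mul_assoc, ← mul_sub]
    exact ((X_pow_dvd_sub_iff_phi (coef_of_lt_three β) y n _).mpr h).mul_left _
  have hαt : ∀ c p q, bracket α (c • e n 0 + tail n p) (tail n q) =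
      tail n (X * (C c + p) * (C (constantCoeff q) * paramSeries α.coef) +
        C (c * constantCoeff q * (α.θ - α.coef n)) * X ^ (n - 1)) := by
    intro c p q
    simpa using bracket_tail hn α c 0 p q
  have hβt : ∀ c p q, bracket β (c • e n 0 + tail n p) (tail n q) =
      tail n (X * (C c + p) * (C (constantCoeff q) * b) +
        C (c * constantCoeff q * (β.θ - β.coef n)) * X ^ (n - 1)) := by
    intro c p q
    simpa using bracket_tail hn β c 0 p q
  have hβv : ∀ c p, bracket β (c • e n 0 + tail n p) v =
      tail n (X * (C c + p) * M + C (c * (A * y) * (β.θ - β.coef n)) * X ^ (n - 1)) := by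
    intro c p
    have hw1 : constantCoeff (C (A * y) + w) = A * y := by
      rw [map_add, hw0, add_zero, constantCoeff_C]
    rw [hv, bracket_tail hn, ← hb, hw1, hM]
    congr 2
    simp only [map_mul]
    ring
  have he0 : e n 0 = (1 : ℂ) • e n 0 + tail n 0 := by rw [one_smul, map_zero, add_zero]
  have ht0 : ∀ p, tail n p = (0 : ℂ) • e n 0 + tail n p := by
    intro p
    rw [zero_smul, zero_add]
  have hβ0 : ∀ p, bracket β (tail n p) v = tail n (X * p * M) := by
    intro p
    simpa using hβv 0 p
  have hXn : (X : ℂ⟦X⟧) ^ n = X ^ (n - 1) * X := by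
    rw [← pow_succ, Nat.sub_add_cancel (by omega)]
  have hbrk : (bracket α).compr₂ g = (bracket β).compl₁₂ g g := by
    refine (Pi.basisFun ℂ (Fin (n + 1))).ext fun i => (Pi.basisFun ℂ (Fin (n + 1))).ext fun j => ?_
    rw [LinearMap.compr₂_apply, LinearMap.compl₁₂_apply, basisFun_eq_e, basisFun_eq_e]
    refine Fin.cases ?_ (fun i => ?_) i <;> refine Fin.cases ?_ (fun j => ?_) j
    · rw [Fin.val_zero, hg0]
      nth_rewrite 2 [hv]
      have h00 := bracket_tail_e_zero hn α 1 0
      rw [← he0] at h00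
      rw [hβv, h00, map_one, add_zero, mul_one, ← pow_one X, hgX, pow_one,
        pow_one, tail_eq_tail_iff]
      have h1 := X_pow_dvd_X_pow_mul_sub (n := n) (by omega) M
      rw [hM0] at h1
      refine (h1.mul_left (C (A * y * (β.θ - β.coef n)))).trans (dvd_of_eq ?_)
      have : X * (C A + (C (A * y) + w)) * M = X * M * C (A * (1 + y)) + X * w * M := by
        simp only [map_mul, map_add, map_one]
        ring
      rw [this, hXw]
      simp only [map_mul, map_neg]
      ring
    · rw [Fin.val_zero, Fin.val_succ, e_succ, hg0, hgX, hv, hβt]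
      conv_lhs => rw [he0]
      rw [hαt]
      rcases Nat.eq_zero_or_pos (j : ℕ) with hj | hj
      · simp only [hj, pow_zero, one_mul, map_one, map_add, add_zero, mul_one, constantCoeff_C]
        have h1 := powMap_tail_X_pow_mul_paramSeries v hXM (C (A * (1 + y))) α 0
        rw [pow_zero, pow_zero, one_mul, one_mul, ← hg] at h1
        rw [h1, tail_C_mul, map_smul, hgX, ← tail_C_mul, ← map_add, ← map_add,
          tail_eq_tail_iff]
        have h2 := X_pow_dvd_X_pow_mul_sub (n := n) (by omega) (M ^ (n - 1))
        rw [map_pow, hM0] at h2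
        have h3 : X ^ n ∣ X * w * (C (A * (1 + y)) * b) := by
          refine ⟨C (-(A * y) * (β.θ - β.coef n)) * C (A * (1 + y)) * shiftedSeries β.coef, ?_⟩
          rw [hXw, hb, paramSeries, hXn]
          ring
        -- For `[e_0, e_1]`: `hsum` matches the main terms, `h2` replaces `M^{n-1}` by `A^{n-1}` so
        -- that `hθ` applies, and `h3` discards the contribution of `w`.
        have h4 := dvd_sub (dvd_add (hsum.mul_right (C (A * (1 + y))))
          (h2.mul_left (C (α.θ - α.coef n) * C (A * (1 + y))))) h3
        refine h4.trans (dvd_of_eq ?_)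
        have hA1 : A ^ (n - 1) = A ^ (n - 2) * A := by
          rw [← pow_succ, show n - 2 + 1 = n - 1 by omega]
        rw [← hθ, hA1]
        simp only [map_mul, map_add, map_one, mul_pow, map_pow]
        ring
      · have hjX : ∀ (m c : ℂ⟦X⟧), constantCoeff ((X * m) ^ (j : ℕ) * c) = 0 := by
          intro m c
          rw [map_mul, map_pow, map_mul, constantCoeff_X, zero_mul, zero_pow hj.ne', zero_mul]
        have hjX' : constantCoeff ((X : ℂ⟦X⟧) ^ (j : ℕ)) = 0 := by
          simpa using hjX 1 1
        rw [hjX, hjX']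
        simp
    · rw [Fin.val_zero, Fin.val_succ, e_succ, hg0, hgX, ht0, bracket_tail_e_zero hn, map_zero,
        zero_add, ← pow_succ', hgX, hβ0]
      congr 1
      ring
    · rw [Fin.val_succ, Fin.val_succ, e_succ, e_succ, hgX, hgX, ht0 (X ^ (i : ℕ)), hαt,
        ht0 (_ * _), hβt]
      rcases Nat.eq_zero_or_pos (j : ℕ) with hj | hj
      · have h1 := powMap_tail_X_pow_mul_paramSeries v hXM (C (A * (1 + y))) α i
        rw [← hg] at h1
        simp only [hj, pow_zero, one_mul, map_one, map_zero, zero_add, zero_mul, add_zero,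
          constantCoeff_C]
        rw [show X * X ^ (i : ℕ) * paramSeries α.coef =
          X ^ (i : ℕ) * (X * paramSeries α.coef) by ring, h1, tail_eq_tail_iff]
        refine (hsum.mul_right ((X * M) ^ (i : ℕ) * C (A * (1 + y)))).trans (dvd_of_eq ?_)
        ring
      · have hjX : ∀ (m c : ℂ⟦X⟧), constantCoeff ((X * m) ^ (j : ℕ) * c) = 0 := by
          intro m c
          rw [map_mul, map_pow, map_mul, constantCoeff_X, zero_mul, zero_pow hj.ne', zero_mul]
        have hjX' : constantCoeff ((X : ℂ⟦X⟧) ^ (j : ℕ)) = 0 := by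
          simpa using hjX 1 1
        rw [hjX, hjX']
        simp
  exact ⟨LinearEquiv.ofInjectiveEndo g hinj, fun x z => LinearMap.congr_fun₂ hbrk x z⟩

/-! ### Normal forms and the classification -/

/-- The parameters with `α₃ = 0`, `α₄ = α₅ = 1`, `α_t = a_{t-2}` for `t ≥ 6` and
`θ = a_{n-1}`. -/
def normalForm (n : ℕ) (a : ℕ → ℂ) : Params n where
  a t := if (t : ℕ) = 3 then 0 else if (t : ℕ) ≤ 5 then 1 else a (t - 2)
  θ := a (n - 1)

lemma coef_normalForm {n : ℕ} (a : ℕ → ℂ) {t : ℕ} (h3 : 3 ≤ t) (hn : t ≤ n) :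
    (normalForm n a).coef t = if t = 3 then 0 else if t ≤ 5 then 1 else a (t - 2) :=
  dif_pos ⟨h3, hn⟩

lemma normalForm_congr {n : ℕ} (hn : 5 ≤ n) {a b : ℕ → ℂ}
    (h : ∀ i ∈ Finset.Icc 4 (n - 1), a i = b i) : normalForm n a = normalForm n b := by
  have hθ := h (n - 1) (Finset.mem_Icc.mpr ⟨by omega, le_rfl⟩)
  simp only [normalForm, Params.mk.injEq, hθ, and_true]
  ext t
  have ht := t.2.2
  split_ifs with h1 h2
  · rfl
  · rfl
  · exact h _ (Finset.mem_Icc.mpr ⟨by omega, by omega⟩)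

lemma mem_setU2_iff {n : ℕ} {α : Params n} :
    α ∈ setU2 n ↔ α.coef 3 = 0 ∧ α.coef 4 ≠ 0 ∧ α.coef 5 ≠ 0 := by
  simp only [setU2, setU2Prime, setF, Set.mem_ofPred_eq]
  constructor
  · rintro ⟨⟨_, h3, h4⟩, h5⟩
    exact ⟨h3, by simpa [h3] using h4, h5⟩
  · rintro ⟨h3, h4, h5⟩
    exact ⟨⟨by simp [h3], h3, by simpa [h3] using h4⟩, h5⟩

lemma normalForm_mem_setU2 {n : ℕ} (hn : 5 ≤ n) (a : ℕ → ℂ) : normalForm n a ∈ setU2 n := by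
  rw [mem_setU2_iff, coef_normalForm a le_rfl (by omega), coef_normalForm a (by omega) (by omega),
    coef_normalForm a (by omega) (by omega)]
  norm_num

lemma phi_three (z : ℕ → ℂ) (y : ℂ) : phi z y 3 = (1 + y) * z 3 := by
  rw [phi_eq, Finset.Icc_eq_empty (by omega), Finset.sum_empty, sub_zero]

lemma phi_four {z : ℕ → ℂ} (h3 : z 3 = 0) (y : ℂ) : phi z y 4 = (1 + y) * z 4 := by
  rw [phi_eq, Finset.sum_eq_zero, sub_zero]
  intro k hk
  obtain rfl : k = 3 := by have := Finset.mem_Icc.mp hk; omega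
  rw [phi_three, h3, mul_zero, mul_zero]

lemma phi_five {z : ℕ → ℂ} (hz : ∀ t < 3, z t = 0) (h3 : z 3 = 0) (y : ℂ) :
    phi z y 5 = (1 + y) * z 5 := by
  rw [phi_eq, Finset.sum_eq_zero, sub_zero]
  intro k hk
  obtain rfl | rfl : k = 3 ∨ k = 4 := by have := Finset.mem_Icc.mp hk; omega
  · rw [phi_three, h3, mul_zero, mul_zero]
  -- Only `j = 1` could contribute, with a multiple of `z 3 = 0`; for `j ≥ 2` the nested sums are
  -- empty.
  · rw [recCoef, Finset.sum_eq_zero, zero_mul]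
    intro j hj
    have := (Finset.mem_Icc.mp hj).1
    obtain rfl | hj2 : j = 1 ∨ 2 ≤ j := by omega
    · simp [nestedSum, h3]
    · rw [nestedSum_eq_zero hz _ _ _ _ (by omega), mul_zero]

/-- Since `α_4 = α_5 = 1`, the invariants are evaluated at `x = 1`, `y = 0`, where `φ_t` is just
`α_t`. -/
lemma inv2_normalForm {n : ℕ} (hn : 5 ≤ n) (a : ℕ → ℂ) {i : ℕ} (hi : 4 ≤ i) (hin : i ≤ n - 1) :
    inv2 i (normalForm n a) = a i := by
  rw [inv2, coef_normalForm a (by omega) (by omega), coef_normalForm a (by omega) (by omega)]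
  norm_num
  rw [rho]
  split_ifs with h
  · rw [phiLast_eq, phi_zero_right, h, one_pow, one_mul, add_sub_cancel]
    rfl
  · rw [phi_zero_right, coef_normalForm a (by omega) (by omega), if_neg (by omega),
      if_neg (by omega), one_pow, one_mul, Nat.add_sub_cancel]

/-- Normalising means `A^2 = (1 + y) α_4` and `A^3 = (1 + y) α_5`, so `A = α_5 / α_4` and `1 + y =
α_5^2 / α_4^3`: this is where the arguments of `ρ_i` come from, with `x = A⁻¹`. -/
lemma isomorphic_normalForm {n : ℕ} (hn : 5 ≤ n) {α : Params n} (hα : α ∈ setU2 n) :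
    Isomorphic (normalForm n fun i => inv2 i α) α := by
  obtain ⟨h3, h4, h5⟩ := mem_setU2_iff.mp hα
  have hx : α.coef 4 / α.coef 5 ≠ 0 := div_ne_zero h4 h5
  have hcoef : ∀ t, 3 ≤ t → t ≤ n →
      (normalForm n fun i => inv2 i α).coef t * (α.coef 4 / α.coef 5)⁻¹ ^ (t - 2) =
        phi α.coef (α.coef 5 ^ 2 / α.coef 4 ^ 3 - 1) t := by
    intro t ht htn
    rw [coef_normalForm _ ht htn]
    obtain rfl | rfl | rfl | h6 : t = 3 ∨ t = 4 ∨ t = 5 ∨ 6 ≤ t := by omega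
    · simp [phi_three, h3]
    · rw [phi_four h3]
      norm_num
      field_simp
    · rw [phi_five (coef_of_lt_three α) h3]
      norm_num
      field_simp
    · rw [if_neg (by omega), if_neg (by omega), inv2, rho, if_neg (by omega),
        Nat.sub_add_cancel (by omega), inv_pow, mul_comm,
        inv_mul_cancel_left₀ (pow_ne_zero _ hx)]
  refine isomorphic_of_phi_eq (by omega) (inv_ne_zero hx)
    (y := α.coef 5 ^ 2 / α.coef 4 ^ 3 - 1) ?_ hcoef ?_
  · rw [add_sub_cancel]
    exact div_ne_zero (pow_ne_zero _ h5) (pow_ne_zero _ h4)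
  · rw [sub_mul, hcoef n (by omega) le_rfl,
      show (normalForm n fun i => inv2 i α).θ = inv2 (n - 1) α from rfl, inv2, rho, if_pos rfl,
      phiLast_eq, inv_pow, mul_comm, inv_mul_cancel_left₀ (pow_ne_zero _ hx), add_sub_cancel_left]

/-- Degrees `4` and `5` give `A^2 = 1 + y = A^3`, so `A = 1` and `y = 0`, which leaves all
parameters unchanged. -/
lemma eq_of_isomorphic_normalForm {n : ℕ} (hn : 5 ≤ n) {a b : ℕ → ℂ}
    (h : Isomorphic (normalForm n a) (normalForm n b)) :
    ∀ i ∈ Finset.Icc 4 (n - 1), a i = b i := by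
  obtain ⟨A, y, hA, -, hφ, hθ⟩ := h.exists_phi_eq (by omega)
  have hb3 : (normalForm n b).coef 3 = 0 := by
    rw [coef_normalForm b le_rfl (by omega), if_pos rfl]
  have h4 := hφ 4 (by omega) (by omega)
  have h5 := hφ 5 (by omega) (by omega)
  rw [phi_four hb3] at h4
  rw [phi_five (coef_of_lt_three _) hb3] at h5
  simp only [coef_normalForm _ (show 3 ≤ 4 by omega) (show 4 ≤ n by omega),
    coef_normalForm _ (show 3 ≤ 5 by omega) hn] at h4 h5
  norm_num at h4 h5
  have hA1 : A = 1 := mul_left_cancel₀ (pow_ne_zero 2 hA) (by linear_combination h5 - h4)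
  have hy : y = 0 := by
    rw [hA1] at h4
    linear_combination -h4
  subst hA1 hy
  simp only [one_pow, mul_one, phi_zero_right] at hφ hθ
  intro i hi
  obtain ⟨hi4, hin⟩ := Finset.mem_Icc.mp hi
  obtain rfl | hlt : i = n - 1 ∨ i < n - 1 := by omega
  · rw [hφ n (by omega) le_rfl] at hθ
    exact sub_left_inj.mp hθ
  · have := hφ (i + 2) (by omega) (by omega)
    rwa [coef_normalForm _ (by omega) (by omega), coef_normalForm _ (by omega) (by omega),
      if_neg (by omega), if_neg (by omega), if_neg (by omega), if_neg (by omega),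
      Nat.add_sub_cancel] at this

end FiliformLeibniz

end

theorem theorem5 (n : ℕ) (hn : 5 ≤ n) :
    (∀ α ∈ FiliformLeibniz.setU2 n, ∀ β ∈ FiliformLeibniz.setU2 n,
      (FiliformLeibniz.Isomorphic α β ↔
        ∀ i ∈ Finset.Icc 4 (n - 1),
          FiliformLeibniz.inv2 i α = FiliformLeibniz.inv2 i β)) ∧
    (∀ a : Set.Icc 4 (n - 1) → ℂ, ∃ α ∈ FiliformLeibniz.setU2 n,
      ∀ i : Set.Icc 4 (n - 1), FiliformLeibniz.inv2 (i : ℕ) α = a i) := by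
  refine ⟨fun α hα β hβ => ?_, fun a => ?_⟩
  · have hNα := FiliformLeibniz.isomorphic_normalForm hn hα
    have hNβ := FiliformLeibniz.isomorphic_normalForm hn hβ
    constructor
    · intro h
      exact FiliformLeibniz.eq_of_isomorphic_normalForm hn ((hNα.trans h).trans hNβ.symm)
    · intro h
      rw [FiliformLeibniz.normalForm_congr hn h] at hNα
      exact hNα.symm.trans hNβ
  · refine ⟨FiliformLeibniz.normalForm n fun i => if h : 4 ≤ i ∧ i ≤ n - 1 then a ⟨i, h⟩ else 0,
      FiliformLeibniz.normalForm_mem_setU2 hn _, fun i => ?_⟩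
    rw [FiliformLeibniz.inv2_normalForm hn _ i.2.1 i.2.2]
    exact dif_pos i.2
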